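/- **Setting.** Consider the discrete-time system $$x(k+1)=Ax(k)+Bu(k)+B_vv(k),\qquad y(k)=Cx(k)+Du(k)+D_wv(k),$$ consisting of $N$ subsystems whose states and inputs have dimensions $n_1,\dots,n_N$ (the $i$-th state $x_i$ and the $i$-th input $u_i$ both lie in $\mathbb R^{n_i}$), with $n=\sum_i n_i$, $A,B\in\mathbb R^{n\times n}$, $B_v\in\mathbb R^{n\times m_v}$, $C,D\in\mathbb R^{l\times n}$, $D_w\in\mathbb R^{l\times m_v}$. Let $\mathcal G=(\{1,\dots,N\},\mathcal E)$ be an undirected graph, and let $$\mathcal S=\{K\in\mathbb R^{n\times n}: K_{ij}=O_{n_i\times n_j}\text{ whenever } i\ne j,\ (i,j)\notin\mathcal E\}.$$ Let $\mathcal C_1,\dots,\mathcal C_q$ be cliques of $\mathcal G$ such that every node lies in at least one of them and two distinct nodes $i,j$ lie in a common $\mathcal C_k$ if and only if $(i,j)\in\mathcal E$. Put $n_{\mathcal C_k}=\sum_{j\in\mathcal C_k}n_j$ and $\tilde n=\sum_k n_{\mathcal C_k}$. Let $E_j\in\mathbb R^{n_j\times n}$ be the matrix that selects the $j$-th block $x_j$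 of $x$, let $E_{\mathcal C_k}\in\mathbb R^{n_{\mathcal C_k}\times n}$ be the stack of the $E_j$, $j\in\mathcal C_k$, and let $E\in\mathbb R^{\tilde n\times n}$ be the stack of $E_{\mathcal C_1},\dots,E_{\mathcal C_q}$. Put $$N_E=I-E(E^\top E)^{-1}E^\top,\qquad M={\rm blkdiag}(N_E,N_E),$$ $$\tilde A=EA(E^\top E)^{-1}E^\top,\quad \tilde B=EB(E^\top E)^{-1}E^\top,\quad \tilde B_v=EB_v,\quad \tilde C=C(E^\top E)^{-1}E^\top,\quad \tilde D=D(E^\top E)^{-1}E^\top .$$ For matrices of compatible sizes let $$\Theta_\gamma(G,Q,Z)=\begin{bmatrix}-Q&\ast&\ast&\ast\\ (AG+BZ)^\top&Q-G-G^\top&\ast&\ast\\ B_v^\top&O&-\gamma I&\ast\\ O&CG+DZ&D_w&-\gamma I\end{bmatrix},$$ where $\ast$ denotes the blocks determined by symmetry. Let $\tilde\Theta_\gamma(\tilde G,\tilde Q,\tilde Z)$ be the same expression formed with $\tilde A,\tilde B,\tilde B_v,\tilde C,\tilde D,D_w$, and let $\tilde\Gamma_\gamma(\tilde Q,\tilde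 Z)$ be obtained from $\tilde\Theta_\gamma(\tilde Q,\tilde Q,\tilde Z)$ by writing its second diagonal block as $-\tilde Q$. Below, $O$ in ${\rm blkdiag}(\rho M,O)$ is the zero matrix of size $m_v+l$; a "clique-wise block-diagonal" matrix is one of the form ${\rm blkdiag}(X_1,\dots,X_q)$ with $X_k\in\mathbb R^{n_{\mathcal C_k}\times n_{\mathcal C_k}}$; and $\succ,\prec,\succeq$ refer to the order of real symmetric matrices. For $\gamma>0$ define four sets of gains. * $\mathcal K_{\rm all}^{\infty,\gamma}$ is the set of all $K\in\mathcal S$ such that $A+BK$ is Schur (all its eigenvalues lie in the open unit disc) and $\|T\|_\infty<\gamma$, where $T(z)=(C+DK)(zI-(A+BK))^{-1}B_v+D_w$ and $\|T\|_\infty=\sup_{|z|=1}\sigma_{\max}(T(z))$. * $\mathcal K_{\rm ext}^{\infty,\gamma}$ is the set of all $ZG^{-1}$ with $Z\in\mathcal S$ and $G={\rm blkdiag}(G_1,\dots,G_N)$, $G_i\in\mathbb R^{n_i\times n_i}$, for which some $Q\succ O$ satisfies $\Theta_\gamma(G,Q,Z)\prec O$. * $\mathcal K_{\mathcal S}^{\infty,\gamma}$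 is the set of all $(E^\top E)^{-1}E^\top\tilde Z\tilde Q^{-1}E$ with clique-wise block-diagonal $\tilde Z$ and $\tilde Q\succ O$ for which there are $\rho\in\mathbb R$ and $\eta>0$ with $\tilde\Gamma_\gamma(\tilde Q,\tilde Z)+{\rm blkdiag}(\rho M,O)\prec O$ and $N_E\tilde Q+\tilde QN_E\succeq\eta N_E$. * $\mathcal K_{\mathcal S,{\rm ext}}^{\infty,\gamma}$ is the set of all $(E^\top E)^{-1}E^\top\tilde Z\tilde G^{-1}E$ with clique-wise block-diagonal $\tilde Z$ and $\tilde G$ for which there are $\tilde Q\succ O$ (of size $\tilde n\times\tilde n$, without structural constraint), $\rho\in\mathbb R$ and $\eta>0$ with $\tilde\Theta_\gamma(\tilde G,\tilde Q,\tilde Z)+{\rm blkdiag}(\rho M,O)\prec O$ and $\tilde G^\top N_E+N_E\tilde G\succeq\eta N_E$. **Theorem 2.** For every $\gamma>0$, $$\mathcal K_{\rm ext}^{\infty,\gamma}\cup\mathcal K_{\mathcal S}^{\infty,\gamma}\subset\mathcal K_{\mathcal S,{\rm ext}}^{\infty,\gamma}\subset\mathcal K_{\rm all}^{\infty,\gamma}.$$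 -/

import Mathlib

open scoped Matrix

noncomputable section

namespace CliqueHinf

/-! ## Order relations between real matrices -/

/-- `X ≺ O`: `X` is symmetric negative definite. -/
def NegDef {α : Type*} [Fintype α] (X : Matrix α α ℝ) : Prop := (-X).PosDef

/-- `X ⪰ Y`: the difference `X - Y` is symmetric positive semidefinite. -/
def LoewnerGE {α : Type*} [Fintype α] (X Y : Matrix α α ℝ) : Prop := (X - Y).PosSemidef

/-! ## The interconnected system

There are `N` subsystems; the `i`-th one has a state and an input of the same dimension `n i`. -/

/-- Coordinates of `ℝⁿ = ℝ^{n₁} × ⋯ × ℝ^{n_N}`, grouped by subsystem. -/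
abbrev StateIdx {N : ℕ} (n : Fin N → ℕ) : Type := Σ i : Fin N, Fin (n i)

/-- The data of the plant
`x(k+1) = A x(k) + B u(k) + B_v v(k)`, `y(k) = C x(k) + D u(k) + D_w v(k)`,
with `v(k) ∈ ℝ^{mv}` and `y(k) ∈ ℝ^l`. -/
structure Plant {N : ℕ} (n : Fin N → ℕ) (mv l : ℕ) where
  A : Matrix (StateIdx n) (StateIdx n) ℝ
  B : Matrix (StateIdx n) (StateIdx n) ℝ
  Bv : Matrix (StateIdx n) (Fin mv) ℝ
  C : Matrix (Fin l) (StateIdx n) ℝ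
  D : Matrix (Fin l) (StateIdx n) ℝ
  Dw : Matrix (Fin l) (Fin mv) ℝ

/-- The set `𝒮` of matrices whose `(i, j)` block vanishes whenever `i ≠ j` is not an edge. -/
def sparse {N : ℕ} (𝒢 : SimpleGraph (Fin N)) (n : Fin N → ℕ) :
    Set (Matrix (StateIdx n) (StateIdx n) ℝ) :=
  {K | ∀ i j : Fin N, i ≠ j → ¬ 𝒢.Adj i j →
    ∀ (a : Fin (n i)) (b : Fin (n j)), K ⟨i, a⟩ ⟨j, b⟩ = 0}

/-! ## The `H_∞` norm of the closed loop `u = K x` -/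

section Closed

variable {N : ℕ} {n : Fin N → ℕ} {mv l : ℕ}

/-- Entrywise inclusion of real matrices in complex matrices. -/
def toComplex {α β : Type*} (X : Matrix α β ℝ) : Matrix α β ℂ := X.map Complex.ofReal

/-- A real square matrix is Schur if all its complex eigenvalues lie in the open unit disc. -/
def IsSchur {α : Type*} [Fintype α] [DecidableEq α] (X : Matrix α α ℝ) : Prop :=
  ∀ z ∈ spectrum ℂ (toComplex X), ‖z‖ < 1

/-- The closed-loop transfer matrix `T(z) = (C + D K) (z I - (A + B K))⁻¹ B_v + D_w`. -/
def transfer (S : Plant n mv l) (K : Matrix (StateIdx n) (StateIdx n) ℝ) (z : ℂ) :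
    Matrix (Fin l) (Fin mv) ℂ :=
  toComplex (S.C + S.D * K) * (z • 1 - toComplex (S.A + S.B * K))⁻¹ * toComplex S.Bv
    + toComplex S.Dw

open scoped Matrix.Norms.L2Operator in
/-- The supremum over the unit circle of the largest singular value (the spectral norm) of `T(z)`;
this is the `H_∞` norm when `T` is stable. -/
def hinfNorm {α β : Type*} [Fintype α] [Fintype β] [DecidableEq β]
    (T : ℂ → Matrix α β ℂ) : ENNReal :=
  ⨆ z : {z : ℂ // ‖z‖ = 1}, ‖T z‖ₑ

/-- `𝒦_all^{∞,γ}`: the sparse gains with Schur closed loop and `‖T‖_∞ < γ`. -/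
def Kall (𝒢 : SimpleGraph (Fin N)) (S : Plant n mv l) (γ : ℝ) :
    Set (Matrix (StateIdx n) (StateIdx n) ℝ) :=
  {K | K ∈ sparse 𝒢 n ∧ IsSchur (S.A + S.B * K) ∧
    hinfNorm (transfer S K) < ENNReal.ofReal γ}

end Closed

/-! ## The block matrices of the matrix inequalities -/

section Blocks

variable {σ ν o : Type*} [Fintype σ] [DecidableEq ν] [DecidableEq o]

/-- The symmetric block matrix with lower triangle
```
  -Q
  (A G + B Z)ᵀ   Q - G - Gᵀ
  B_vᵀ           O             -γ I
  O              C G + D Z     D_w     -γ I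
```
-/
def Theta (A B : Matrix σ σ ℝ) (Bv : Matrix σ ν ℝ) (C D : Matrix o σ ℝ) (Dw : Matrix o ν ℝ)
    (γ : ℝ) (G Q Z : Matrix σ σ ℝ) : Matrix ((σ ⊕ σ) ⊕ (ν ⊕ o)) ((σ ⊕ σ) ⊕ (ν ⊕ o)) ℝ :=
  Matrix.fromBlocks
    (Matrix.fromBlocks (-Q) (A * G + B * Z) (A * G + B * Z)ᵀ (Q - G - Gᵀ))
    (Matrix.fromBlocks Bv 0 0 (C * G + D * Z)ᵀ)
    (Matrix.fromBlocks Bvᵀ 0 0 (C * G + D * Z))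
    (Matrix.fromBlocks (-(γ • 1)) Dwᵀ Dw (-(γ • 1)))

/-- The symmetric block matrix with lower triangle
```
  -Q
  (A Q + B Z)ᵀ   -Q
  B_vᵀ           O             -γ I
  O              C Q + D Z     D_w     -γ I
```
-/
def Gamma (A B : Matrix σ σ ℝ) (Bv : Matrix σ ν ℝ) (C D : Matrix o σ ℝ) (Dw : Matrix o ν ℝ)
    (γ : ℝ) (Q Z : Matrix σ σ ℝ) : Matrix ((σ ⊕ σ) ⊕ (ν ⊕ o)) ((σ ⊕ σ) ⊕ (ν ⊕ o)) ℝ :=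
  Matrix.fromBlocks
    (Matrix.fromBlocks (-Q) (A * Q + B * Z) (A * Q + B * Z)ᵀ (-Q))
    (Matrix.fromBlocks Bv 0 0 (C * Q + D * Z)ᵀ)
    (Matrix.fromBlocks Bvᵀ 0 0 (C * Q + D * Z))
    (Matrix.fromBlocks (-(γ • 1)) Dwᵀ Dw (-(γ • 1)))

end Blocks

/-! ## Clique-wise decomposition

The cliques in use are `C 0, …, C (q - 1)`. -/

section Cliques

variable {N q : ℕ}

/-- Coordinates of `ℝ^{n_{C_k}}`, where `n_{C_k} = ∑_{j ∈ C_k} n_j`. -/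
abbrev BlockIdx (n : Fin N → ℕ) (c : Finset (Fin N)) : Type := Σ j : {j // j ∈ c}, Fin (n j)

/-- Coordinates of the direct sum of the spaces `ℝ^{n_{C_k}}`. -/
abbrev CliqueIdx (n : Fin N → ℕ) (C : Fin q → Finset (Fin N)) : Type :=
  Σ k : Fin q, BlockIdx n (C k)

/-- `E_j = [O, …, I_{n_j}, …, O]`. -/
def Enode (n : Fin N → ℕ) (j : Fin N) : Matrix (Fin (n j)) (StateIdx n) ℝ :=
  Matrix.of fun a c => if (⟨j, a⟩ : StateIdx n) = c then 1 else 0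

/-- `E_{C}`: the matrices `E_j`, `j ∈ C`, stacked. -/
def Eclique (n : Fin N → ℕ) (c : Finset (Fin N)) : Matrix (BlockIdx n c) (StateIdx n) ℝ :=
  Matrix.of fun r s => Enode n r.1 r.2 s

/-- `E`: the matrices `E_{C_k}` stacked. -/
def E (n : Fin N → ℕ) (C : Fin q → Finset (Fin N)) : Matrix (CliqueIdx n C) (StateIdx n) ℝ :=
  Matrix.of fun r s => Eclique n (C r.1) r.2 s

/-- `(EᵀE)⁻¹ Eᵀ`. -/
def Epinv (n : Fin N → ℕ) (C : Fin q → Finset (Fin N)) : Matrix (StateIdx n) (CliqueIdx n C) ℝ :=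
  ((E n C)ᵀ * E n C)⁻¹ * (E n C)ᵀ

/-- The projection `I - E (EᵀE)⁻¹ Eᵀ`. -/
def projN (n : Fin N → ℕ) (C : Fin q → Finset (Fin N)) :
    Matrix (CliqueIdx n C) (CliqueIdx n C) ℝ :=
  1 - E n C * Epinv n C

/-- `blkdiag(M, O)` with `M = blkdiag(projN, projN)`, where the zero block has the size of the
last two block rows of `Theta`. -/
def bigM (n : Fin N → ℕ) (C : Fin q → Finset (Fin N)) (mv l : ℕ) :
    Matrix ((CliqueIdx n C ⊕ CliqueIdx n C) ⊕ (Fin mv ⊕ Fin l))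
      ((CliqueIdx n C ⊕ CliqueIdx n C) ⊕ (Fin mv ⊕ Fin l)) ℝ :=
  Matrix.fromBlocks (Matrix.fromBlocks (projN n C) 0 0 (projN n C)) 0 0 0

variable {n : Fin N → ℕ} {mv l : ℕ} (S : Plant n mv l) (C : Fin q → Finset (Fin N))

/-- The matrix `Theta` of the dilated system
`Ã = E A (EᵀE)⁻¹ Eᵀ`, `B̃ = E B (EᵀE)⁻¹ Eᵀ`, `B̃_v = E B_v`, `C̃ = C (EᵀE)⁻¹ Eᵀ`,
`D̃ = D (EᵀE)⁻¹ Eᵀ`. -/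
def ThetaDilated (γ : ℝ) (G Q Z : Matrix (CliqueIdx n C) (CliqueIdx n C) ℝ) :
    Matrix ((CliqueIdx n C ⊕ CliqueIdx n C) ⊕ (Fin mv ⊕ Fin l))
      ((CliqueIdx n C ⊕ CliqueIdx n C) ⊕ (Fin mv ⊕ Fin l)) ℝ :=
  Theta (E n C * S.A * Epinv n C) (E n C * S.B * Epinv n C) (E n C * S.Bv)
    (S.C * Epinv n C) (S.D * Epinv n C) S.Dw γ G Q Z

/-- The matrix `Gamma` of the dilated system. -/
def GammaDilated (γ : ℝ) (Q Z : Matrix (CliqueIdx n C) (CliqueIdx n C) ℝ) :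
    Matrix ((CliqueIdx n C ⊕ CliqueIdx n C) ⊕ (Fin mv ⊕ Fin l))
      ((CliqueIdx n C ⊕ CliqueIdx n C) ⊕ (Fin mv ⊕ Fin l)) ℝ :=
  Gamma (E n C * S.A * Epinv n C) (E n C * S.B * Epinv n C) (E n C * S.Bv)
    (S.C * Epinv n C) (S.D * Epinv n C) S.Dw γ Q Z

/-! ## The three solution sets -/

/-- `𝒦_ext^{∞,γ}`: the gains `Z G⁻¹` from the extended LMI, with `Z ∈ 𝒮` and
`G = blkdiag(G₁, …, G_N)`. -/
def Kext (𝒢 : SimpleGraph (Fin N)) (γ : ℝ) : Set (Matrix (StateIdx n) (StateIdx n) ℝ) :=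
  {K | ∃ (Z Q : Matrix (StateIdx n) (StateIdx n) ℝ)
      (Gb : (i : Fin N) → Matrix (Fin (n i)) (Fin (n i)) ℝ),
    Z ∈ sparse 𝒢 n ∧ Q.PosDef ∧
    NegDef (Theta S.A S.B S.Bv S.C S.D S.Dw γ (Matrix.blockDiagonal' Gb) Q Z) ∧
    K = Z * (Matrix.blockDiagonal' Gb)⁻¹}

/-- `𝒦_𝒮^{∞,γ}`: the gains `(EᵀE)⁻¹ Eᵀ Z̃ Q̃⁻¹ E` from the clique-wise LMI, with `Z̃` and the
Lyapunov variable `Q̃` clique-wise block-diagonal. -/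
def KS (γ : ℝ) : Set (Matrix (StateIdx n) (StateIdx n) ℝ) :=
  {K | ∃ (Zb Qb : (k : Fin q) → Matrix (BlockIdx n (C k)) (BlockIdx n (C k)) ℝ)
      (ρ η : ℝ),
    (Matrix.blockDiagonal' Qb).PosDef ∧ 0 < η ∧
    NegDef (GammaDilated S C γ (Matrix.blockDiagonal' Qb) (Matrix.blockDiagonal' Zb)
      + ρ • bigM n C mv l) ∧
    LoewnerGE (projN n C * Matrix.blockDiagonal' Qb + Matrix.blockDiagonal' Qb * projN n C)
      (η • projN n C) ∧
    K = Epinv n C * (Matrix.blockDiagonal' Zb * (Matrix.blockDiagonal' Qb)⁻¹) * E n C}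

/-- `𝒦_{𝒮,ext}^{∞,γ}`: the gains `(EᵀE)⁻¹ Eᵀ Z̃ G̃⁻¹ E` from the extended clique-wise LMI, with
`Z̃` and `G̃` clique-wise block-diagonal and an unstructured `Q̃ ≻ O`. -/
def KSext (γ : ℝ) : Set (Matrix (StateIdx n) (StateIdx n) ℝ) :=
  {K | ∃ (Q : Matrix (CliqueIdx n C) (CliqueIdx n C) ℝ)
      (Zb Gb : (k : Fin q) → Matrix (BlockIdx n (C k)) (BlockIdx n (C k)) ℝ)
      (ρ η : ℝ),
    Q.PosDef ∧ 0 < η ∧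
    NegDef (ThetaDilated S C γ (Matrix.blockDiagonal' Gb) Q (Matrix.blockDiagonal' Zb)
      + ρ • bigM n C mv l) ∧
    LoewnerGE
      ((Matrix.blockDiagonal' Gb)ᵀ * projN n C + projN n C * Matrix.blockDiagonal' Gb)
      (η • projN n C) ∧
    K = Epinv n C * (Matrix.blockDiagonal' Zb * (Matrix.blockDiagonal' Gb)⁻¹) * E n C}

end Cliques

end CliqueHinf

end

open CliqueHinf

open CliqueHinf
open scoped ComplexOrder

/-! Write P = (EᵀE)⁻¹Eᵀ, N = I - EP and H = EᵀE. H is diagonal with the node multiplicities, which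
are positive because the cliques cover, so PE = I and N is the orthogonal projection with kernel
range E.

The dilated and original inequalities are linked by the congruence with blkdiag(Pᵀ, Pᵀ, I, I)
(`dilation_congruence`). Its range is exactly the kernel of `bigM`, so the dilated inequality
restricts to the original one whatever ρ is. Conversely, Finsler's lemma (`exists_smul_sub_posDef`)
supplies a ρ that extends the original inequality to the whole dilated space.

From the extended clique-wise set to all gains: the multiplier inequality makes range E invariant
under G̃, whence K(PG̃Pᵀ) = PZ̃Pᵀ. The restricted inequality then certifies K through the extended
bounded real lemma (`exists_dissipation`). Sparsity holds because Z̃G̃⁻¹ is clique-wise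
block-diagonal.

From the node-wise extended set: copy G to every clique with each block scaled by its multiplicity
(`liftBlocks`), spread HZH over the cliques to get Z̃, and take Q̃ = EQEᵀ + N. Compression by P
returns G, Z and Q, and Finsler's lemma finishes. From the set with structured Q̃, simply put G̃ =
Q̃. -/

namespace CliqueHinf

/-! ### Definite matrices and Finsler's lemma -/

section Definite

variable {ι : Type*} [Fintype ι]

theorem posDef_iff_real {X : Matrix ι ι ℝ} :
    X.PosDef ↔ Xᵀ = X ∧ ∀ x : ι → ℝ, x ≠ 0 → 0 < x ⬝ᵥ X *ᵥ x := by
  rw [Matrix.posDef_iff_dotProduct_mulVec, Matrix.IsHermitian,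
    Matrix.conjTranspose_eq_transpose_of_trivial]
  simp only [star_trivial]

theorem posSemidef_iff_real {X : Matrix ι ι ℝ} :
    X.PosSemidef ↔ Xᵀ = X ∧ ∀ x : ι → ℝ, 0 ≤ x ⬝ᵥ X *ᵥ x := by
  rw [Matrix.posSemidef_iff_dotProduct_mulVec, Matrix.IsHermitian,
    Matrix.conjTranspose_eq_transpose_of_trivial]
  simp only [star_trivial]

/-- Finsler's lemma, for a positive semidefinite constraint matrix. -/
theorem exists_smul_sub_posDef {X M : Matrix ι ι ℝ} (hX : Xᵀ = X) (hM : M.PosSemidef)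
    (h : ∀ x : ι → ℝ, x ≠ 0 → M *ᵥ x = 0 → x ⬝ᵥ X *ᵥ x < 0) :
    ∃ c : ℝ, 0 < c ∧ (c • M - X).PosDef := by
  have hM' := posSemidef_iff_real.1 hM
  let f : (ι → ℝ) → ℝ := fun x => x ⬝ᵥ X *ᵥ x
  let g : (ι → ℝ) → ℝ := fun x => x ⬝ᵥ M *ᵥ x
  have hf : Continuous f := by fun_prop
  have hg : Continuous g := by fun_prop
  have hker : ∀ x : ι → ℝ, x ≠ 0 → 0 ≤ f x → 0 < g x := by
    intro x hx hfx
    refine lt_of_le_of_ne (hM'.2 x) fun h0 => ?_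
    have := (hM.dotProduct_mulVec_zero_iff x).1 (by simpa using h0.symm)
    exact absurd (h x hx this) (not_lt.2 hfx)
  have hK : IsCompact (Metric.sphere (0 : ι → ℝ) 1 ∩ {x | 0 ≤ f x}) :=
    (isCompact_sphere _ _).inter_right (isClosed_le continuous_const hf)
  have hne : ∀ x ∈ Metric.sphere (0 : ι → ℝ) 1, x ≠ 0 := by
    rintro x hx rfl
    simp at hx
  -- On the compact part of the sphere where f ≥ 0, g is positive, so f / g is bounded by some b.
  -- The constant |b| + 1 is positive and makes the bound strict; where f < 0 any nonnegative
  -- constant works.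
  obtain ⟨b, hb⟩ := hK.bddAbove_image (f := fun x => f x / g x)
    (hf.continuousOn.div hg.continuousOn fun x hx => (hker x (hne x hx.1) hx.2).ne')
  have hsphere : ∀ x ∈ Metric.sphere (0 : ι → ℝ) 1, f x < (|b| + 1) * g x := by
    intro x hx
    rcases lt_or_ge (f x) 0 with h0 | h0
    · exact h0.trans_le (mul_nonneg (by positivity) (hM'.2 x))
    · have hpos := hker x (hne x hx) h0
      have h1 : f x / g x ≤ b := hb ⟨x, ⟨hx, h0⟩, rfl⟩
      rw [div_le_iff₀ hpos] at h1
      nlinarith [le_abs_self b]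
  refine ⟨|b| + 1, by positivity, posDef_iff_real.2 ⟨?_, fun x hx => ?_⟩⟩
  · rw [Matrix.transpose_sub, Matrix.transpose_smul, hM'.1, hX]
  · have hx' : 0 < ‖x‖ := norm_pos_iff.2 hx
    have h1 := hsphere (‖x‖⁻¹ • x) (by simp [norm_smul, hx'.ne'])
    have e1 : f (‖x‖⁻¹ • x) = ‖x‖⁻¹ ^ 2 * f x := by
      simp [f, Matrix.mulVec_smul]; ring
    have e2 : g (‖x‖⁻¹ • x) = ‖x‖⁻¹ ^ 2 * g x := by
      simp [g, Matrix.mulVec_smul]; ring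
    rw [e1, e2, mul_left_comm] at h1
    have h2 := lt_of_mul_lt_mul_left h1 (by positivity)
    rw [Matrix.sub_mulVec, Matrix.smul_mulVec, dotProduct_sub, dotProduct_smul]
    exact sub_pos.2 h2

/-- Finsler's lemma with constraint matrix X, whose kernel is trivial, gives cX - I ≻ 0; divide by
c. -/
theorem exists_sub_smul_one_posDef [DecidableEq ι] {X : Matrix ι ι ℝ} (hX : X.PosDef) :
    ∃ ε : ℝ, 0 < ε ∧ (X - ε • 1).PosDef := by
  obtain ⟨c, hc, h⟩ := exists_smul_sub_posDef (X := 1) (by simp) hX.posSemidef fun x hx h0 => by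
    have := (posDef_iff_real.1 hX).2 x hx
    simp [h0] at this
  refine ⟨c⁻¹, inv_pos.2 hc, ?_⟩
  have := h.smul (inv_pos.2 hc)
  rwa [smul_sub, inv_smul_smul₀ hc.ne'] at this

theorem isUnit_of_forall_mulVec [DecidableEq ι] {X : Matrix ι ι ℝ}
    (h : ∀ x, X *ᵥ x = 0 → x = 0) : IsUnit X := by
  rw [← Matrix.mulVec_injective_iff_isUnit]
  intro x y hxy
  exact sub_eq_zero.1 (h _ (by rw [Matrix.mulVec_sub]; exact sub_eq_zero.2 hxy))

/-- A factorization X = BᴴB survives the inclusion into ℂ. This allows the real inequalities to be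
tested on complex vectors, as eigenvectors and frequency responses require. -/
theorem posSemidef_toComplex [DecidableEq ι] {X : Matrix ι ι ℝ} (hX : X.PosSemidef) :
    (toComplex X).PosSemidef := by
  obtain ⟨B, rfl⟩ : ∃ B : Matrix ι ι ℝ, X = Bᴴ * B := by
    open scoped MatrixOrder in
    exact (CStarAlgebra.nonneg_iff_eq_star_mul_self (a := X)).1 hX.nonneg
  have : toComplex (Bᴴ * B) = (toComplex B)ᴴ * toComplex B := by
    ext i j
    simp [toComplex, Matrix.mul_apply]
  rw [this]
  exact Matrix.posSemidef_conjTranspose_mul_self _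

end Definite

/-! ### Compatibility of the inclusion into complex matrices with matrix operations -/

section ToComplex

variable {α β κ : Type*}

theorem toComplex_mul [Fintype β] (X : Matrix α β ℝ) (Y : Matrix β κ ℝ) :
    toComplex (X * Y) = toComplex X * toComplex Y := by
  ext i j
  simp [toComplex, Matrix.mul_apply]

theorem toComplex_sub (X Y : Matrix α β ℝ) :
    toComplex (X - Y) = toComplex X - toComplex Y := by
  ext i j
  simp [toComplex]

theorem toComplex_neg (X : Matrix α β ℝ) : toComplex (-X) = -toComplex X := by
  ext i j
  simp [toComplex]

theorem toComplex_smul (c : ℝ) (X : Matrix α β ℝ) :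
    toComplex (c • X) = (c : ℂ) • toComplex X := by
  ext i j
  simp [toComplex]

theorem toComplex_zero : toComplex (0 : Matrix α β ℝ) = 0 := by
  ext i j
  simp [toComplex]

theorem toComplex_one [DecidableEq α] : toComplex (1 : Matrix α α ℝ) = 1 := by
  ext i j
  simp [toComplex, Matrix.one_apply, apply_ite Complex.ofReal]

theorem toComplex_transpose (X : Matrix α β ℝ) : toComplex Xᵀ = (toComplex X)ᴴ := by
  ext i j
  simp [toComplex]

theorem toComplex_fromBlocks {δ : Type*} (X : Matrix α β ℝ) (Y : Matrix α δ ℝ) (Z : Matrix κ β ℝ)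
    (W : Matrix κ δ ℝ) :
    toComplex (Matrix.fromBlocks X Y Z W) =
      Matrix.fromBlocks (toComplex X) (toComplex Y) (toComplex Z) (toComplex W) := by
  simp [toComplex, Matrix.fromBlocks_map]

end ToComplex

/-! ### The real part of the Hermitian product -/

section QuadraticForm

/-- The real part of the standard Hermitian product. -/
def rdot {α : Type*} [Fintype α] (x y : α → ℂ) : ℝ := (star x ⬝ᵥ y).re

variable {α β : Type*} [Fintype α] [Fintype β]

theorem rdot_comm (x y : α → ℂ) : rdot x y = rdot y x := by
  have : star x ⬝ᵥ y = star (star y ⬝ᵥ x) := by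
    rw [Matrix.star_dotProduct]
  rw [rdot, rdot, this]
  simp

theorem rdot_add (x y z : α → ℂ) : rdot x (y + z) = rdot x y + rdot x z := by
  simp [rdot, dotProduct_add]

theorem rdot_sub (x y z : α → ℂ) : rdot x (y - z) = rdot x y - rdot x z := by
  simp [rdot, dotProduct_sub]

theorem rdot_neg (x y : α → ℂ) : rdot x (-y) = -rdot x y := by
  simp [rdot]

theorem rdot_zero (x : α → ℂ) : rdot x 0 = 0 := by
  simp [rdot]

theorem rdot_smul (c : ℝ) (x y : α → ℂ) : rdot x ((c : ℂ) • y) = c * rdot x y := by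
  simp [rdot]

theorem rdot_smul_smul (z : ℂ) (x y : α → ℂ) : rdot (z • x) (z • y) = ‖z‖ ^ 2 * rdot x y := by
  have : star (z • x) ⬝ᵥ (z • y) = ((‖z‖ ^ 2 : ℝ) : ℂ) * (star x ⬝ᵥ y) := by
    rw [star_smul, smul_dotProduct, dotProduct_smul, smul_eq_mul, smul_eq_mul, ← mul_assoc]
    congr 1
    push_cast
    exact Complex.conj_mul' z
  rw [rdot, this, Complex.re_ofReal_mul, rdot]

theorem rdot_mulVec (M : Matrix α β ℂ) (x : α → ℂ) (y : β → ℂ) :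
    rdot x (M *ᵥ y) = rdot (Mᴴ *ᵥ x) y := by
  rw [rdot, rdot, Matrix.star_mulVec, Matrix.conjTranspose_conjTranspose,
    Matrix.dotProduct_mulVec]

theorem rdot_self (x : α → ℂ) : rdot x x = ∑ i, ‖x i‖ ^ 2 := by
  simp only [rdot, dotProduct, Pi.star_apply, Complex.re_sum]
  refine Finset.sum_congr rfl fun i _ => ?_
  rw [Complex.star_def, Complex.conj_mul']
  norm_cast

theorem rdot_self_nonneg (x : α → ℂ) : 0 ≤ rdot x x := by
  rw [rdot_self]
  positivity

theorem rdot_self_pos {x : α → ℂ} (hx : x ≠ 0) : 0 < rdot x x := by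
  refine lt_of_le_of_ne (rdot_self_nonneg x) fun h => hx ?_
  rw [rdot_self, eq_comm, Finset.sum_eq_zero_iff_of_nonneg fun i _ => by positivity] at h
  ext i
  simpa using h i (Finset.mem_univ i)

theorem rdot_elim (x x' : α → ℂ) (y y' : β → ℂ) :
    rdot (Sum.elim x y) (Sum.elim x' y') = rdot x x' + rdot y y' := by
  have : star (Sum.elim x y) = Sum.elim (star x) (star y) := by
    ext (i | i) <;> rfl
  rw [rdot, this, sumElim_dotProduct_sumElim, Complex.add_re, rdot, rdot]

theorem rdot_mulVec_self_nonneg {M : Matrix α α ℂ} (hM : M.PosSemidef) (x : α → ℂ) :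
    0 ≤ rdot x (M *ᵥ x) :=
  hM.re_dotProduct_nonneg x

end QuadraticForm

/-! ### The extended bounded real lemma -/

section BoundedReal

variable {σ ν o : Type*} [Fintype σ] [Fintype ν] [Fintype o] [DecidableEq ν]

open scoped Matrix.Norms.L2Operator in
theorem l2_opNorm_le_of_rdot (X : Matrix o ν ℂ) {b : ℝ} (hb : 0 ≤ b)
    (h : ∀ w, rdot (X *ᵥ w) (X *ᵥ w) ≤ b ^ 2 * rdot w w) : ‖X‖ ≤ b := by
  rw [Matrix.l2_opNorm_def]
  refine ContinuousLinearMap.opNorm_le_bound _ hb fun w => ?_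
  have := h w.ofLp
  rw [rdot_self, rdot_self, ← EuclideanSpace.norm_sq_eq w] at this
  refine abs_le_of_sq_le_sq' ?_ (by positivity) |>.2
  rw [mul_pow, EuclideanSpace.norm_sq_eq]
  exact this

variable [DecidableEq o]

/-- Mutually adjoint off-diagonal blocks contribute equal real parts, which explains the factors 2.
-/
theorem rdot_Theta (A B : Matrix σ σ ℝ) (Bv : Matrix σ ν ℝ) (C D : Matrix o σ ℝ)
    (Dw : Matrix o ν ℝ) (γ : ℝ) (G Q Z : Matrix σ σ ℝ) (p s : σ → ℂ) (w : ν → ℂ) (r : o → ℂ) :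
    rdot (Sum.elim (Sum.elim p s) (Sum.elim w r))
        (toComplex (Theta A B Bv C D Dw γ G Q Z) *ᵥ Sum.elim (Sum.elim p s) (Sum.elim w r)) =
      -rdot p (toComplex Q *ᵥ p)
        + 2 * rdot p (toComplex (A * G + B * Z) *ᵥ s + toComplex Bv *ᵥ w)
        + rdot s (toComplex Q *ᵥ s) - 2 * rdot s (toComplex G *ᵥ s)
        + 2 * rdot r (toComplex (C * G + D * Z) *ᵥ s + toComplex Dw *ᵥ w)
        - γ * rdot w w - γ * rdot r r := by
  have e1 : rdot s ((toComplex (A * G + B * Z))ᴴ *ᵥ p) =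
      rdot p (toComplex (A * G + B * Z) *ᵥ s) := by rw [rdot_mulVec _ p, rdot_comm]
  have e2 : rdot s ((toComplex G)ᴴ *ᵥ s) = rdot s (toComplex G *ᵥ s) := by
    rw [rdot_mulVec (toComplex G) s s, rdot_comm]
  have e3 : rdot w ((toComplex Bv)ᴴ *ᵥ p) = rdot p (toComplex Bv *ᵥ w) := by
    rw [rdot_mulVec _ p, rdot_comm]
  have e4 : rdot s ((toComplex (C * G + D * Z))ᴴ *ᵥ r) =
      rdot r (toComplex (C * G + D * Z) *ᵥ s) := by rw [rdot_mulVec _ r, rdot_comm]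
  have e5 : rdot w ((toComplex Dw)ᴴ *ᵥ r) = rdot r (toComplex Dw *ᵥ w) := by
    rw [rdot_mulVec _ r, rdot_comm]
  simp only [Theta, toComplex_fromBlocks, Matrix.fromBlocks_mulVec, Sum.elim_comp_inl,
    Sum.elim_comp_inr, ← Sum.elim_add_add, rdot_elim, rdot_add, toComplex_transpose,
    toComplex_neg, toComplex_sub, toComplex_zero, toComplex_smul, toComplex_one,
    Matrix.neg_mulVec, Matrix.sub_mulVec, Matrix.zero_mulVec, rdot_neg, rdot_sub, rdot_zero,
    Matrix.smul_mulVec, Matrix.one_mulVec, rdot_smul, e1, e2, e3, e4, e5]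
  ring

variable [DecidableEq σ]

/-- The dissipation inequality behind the extended bounded real lemma. -/
theorem exists_dissipation {A B : Matrix σ σ ℝ} {Bv : Matrix σ ν ℝ} {C D : Matrix o σ ℝ}
    {Dw : Matrix o ν ℝ} {γ : ℝ} {G Q Z : Matrix σ σ ℝ} (hγ : 0 < γ) (hQ : Q.PosDef)
    (h : NegDef (Theta A B Bv C D Dw γ G Q Z)) :
    ∃ ε : ℝ, 0 < ε ∧ ∀ (z : ℂ) (s : σ → ℂ) (w : ν → ℂ),
      z • toComplex G *ᵥ s = toComplex (A * G + B * Z) *ᵥ s + toComplex Bv *ᵥ w →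
      ∃ a : ℝ, 0 ≤ a ∧ (‖z‖ ^ 2 - 1) * a
        + γ⁻¹ * rdot (toComplex (C * G + D * Z) *ᵥ s + toComplex Dw *ᵥ w)
            (toComplex (C * G + D * Z) *ᵥ s + toComplex Dw *ᵥ w)
        + ε * rdot s s + ε * rdot w w ≤ γ * rdot w w := by
  obtain ⟨ε, hε, hpos⟩ := exists_sub_smul_one_posDef h
  refine ⟨ε, hε, fun z s w hz => ?_⟩
  set y := toComplex (C * G + D * Z) *ᵥ s + toComplex Dw *ᵥ w with hy
  set g := toComplex G *ᵥ s with hg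
  set R := toComplex Q⁻¹ with hR
  have hQR : toComplex Q * R = 1 := by
    rw [hR, ← toComplex_mul, Matrix.mul_nonsing_inv _ ((Matrix.isUnit_iff_isUnit_det _).1 hQ.isUnit),
      toComplex_one]
  have hRp : R.PosSemidef := posSemidef_toComplex hQ.inv.posSemidef
  refine ⟨rdot g (R *ᵥ g), rdot_mulVec_self_nonneg hRp g, ?_⟩
  -- The first and last components, zQ⁻¹g and γ⁻¹y, maximize the form of `Theta` over those
  -- components once s and w are fixed; this amounts to two Schur complements.
  have key := rdot_mulVec_self_nonneg (posSemidef_toComplex hpos.posSemidef)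
    (Sum.elim (Sum.elim (z • R *ᵥ g) s) (Sum.elim w (((γ⁻¹ : ℝ) : ℂ) • y)))
  rw [toComplex_sub, toComplex_neg, toComplex_smul, toComplex_one, Matrix.sub_mulVec,
    Matrix.neg_mulVec, Matrix.smul_mulVec, Matrix.one_mulVec, rdot_sub, rdot_neg, rdot_smul,
    rdot_Theta, ← hz, ← hy] at key
  simp only [rdot_elim, Matrix.mulVec_smul, Matrix.mulVec_mulVec, hQR, Matrix.one_mulVec,
    rdot_smul_smul, ← hg] at key
  clear_value g
  have c1 : rdot (R *ᵥ g) g = rdot g (R *ᵥ g) := rdot_comm _ _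
  -- Completing the square bounds the block Q - G - Gᵀ from below by -GᵀQ⁻¹G; this is what decouples
  -- G from Q.
  have hsq := rdot_mulVec_self_nonneg hRp (toComplex Q *ᵥ s - g)
  have hQH : (toComplex Q)ᴴ = toComplex Q := by
    rw [← toComplex_transpose, (posDef_iff_real.1 hQ).1]
  have hRQ : R * toComplex Q = 1 := mul_eq_one_comm.1 hQR
  have d1 : rdot (toComplex Q *ᵥ s) (R *ᵥ g) = rdot s g := by
    rw [rdot_comm, rdot_mulVec, hQH, Matrix.mulVec_mulVec, hQR, Matrix.one_mulVec, rdot_comm]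
  have c2 : rdot (toComplex Q *ᵥ s - g) (R *ᵥ (toComplex Q *ᵥ s - g)) =
      rdot s (toComplex Q *ᵥ s) - 2 * rdot s g + rdot g (R *ᵥ g) := by
    rw [Matrix.mulVec_sub, Matrix.mulVec_mulVec, hRQ, Matrix.one_mulVec, rdot_sub,
      rdot_comm _ s, rdot_comm _ (R *ᵥ g), rdot_sub, rdot_sub, rdot_comm (R *ᵥ g), d1, c1]
    ring
  have c3 : ‖((γ⁻¹ : ℝ) : ℂ)‖ ^ 2 = γ⁻¹ ^ 2 := by
    rw [Complex.norm_real, Real.norm_eq_abs, sq_abs]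
  have c4 : rdot (((γ⁻¹ : ℝ) : ℂ) • y) y = γ⁻¹ * rdot y y := by
    rw [rdot_comm, rdot_smul]
  rw [c3, c4, c1] at key
  rw [c2] at hsq
  have n1 : 0 ≤ ‖z‖ ^ 2 * rdot (R *ᵥ g) (R *ᵥ g) := mul_nonneg (by positivity) (rdot_self_nonneg _)
  have n2 : 0 ≤ γ⁻¹ ^ 2 * rdot y y := mul_nonneg (by positivity) (rdot_self_nonneg _)
  have e : γ * (γ⁻¹ ^ 2 * rdot y y) = γ⁻¹ * rdot y y := by
    field_simp
  rw [e] at key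
  have n3 := mul_nonneg hε.le n1
  have n4 := mul_nonneg hε.le n2
  linarith

/-- The extended bounded real lemma: stability. -/
theorem isSchur_of_negDef_Theta {A B : Matrix σ σ ℝ} {Bv : Matrix σ ν ℝ} {C D : Matrix o σ ℝ}
    {Dw : Matrix o ν ℝ} {γ : ℝ} {G Q Z K : Matrix σ σ ℝ} (hγ : 0 < γ) (hQ : Q.PosDef)
    (h : NegDef (Theta A B Bv C D Dw γ G Q Z)) (hG : IsUnit G) (hK : K * G = Z) :
    IsSchur (A + B * K) := by
  intro z hz
  obtain ⟨ε, hε, hd⟩ := exists_dissipation hγ hQ h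
  have hGc : toComplex G * toComplex G⁻¹ = 1 := by
    rw [← toComplex_mul, Matrix.mul_nonsing_inv _ ((Matrix.isUnit_iff_isUnit_det _).1 hG),
      toComplex_one]
  have hAG : A * G + B * Z = (A + B * K) * G := by
    rw [← hK, Matrix.add_mul, Matrix.mul_assoc]
  obtain ⟨x, hx, hx0⟩ : ∃ x, x ≠ 0 ∧ (z • 1 - toComplex (A + B * K)) *ᵥ x = 0 := by
    rw [Matrix.exists_mulVec_eq_zero_iff]
    rw [spectrum.mem_iff, Algebra.algebraMap_eq_smul_one, Matrix.isUnit_iff_isUnit_det,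
      isUnit_iff_ne_zero, not_not] at hz
    exact hz
  rw [Matrix.sub_mulVec, Matrix.smul_mulVec, Matrix.one_mulVec, sub_eq_zero] at hx0
  have hs : toComplex G *ᵥ (toComplex G⁻¹ *ᵥ x) = x := by
    rw [Matrix.mulVec_mulVec, hGc, Matrix.one_mulVec]
  -- Zero disturbance and s = G⁻¹x for an eigenvector x: if |z| ≥ 1, every term on the left is
  -- nonnegative and ε|s|² is positive, while the right side is 0.
  obtain ⟨a, ha, hle⟩ := hd z (toComplex G⁻¹ *ᵥ x) 0 (by
    rw [hs, hAG, toComplex_mul, ← Matrix.mulVec_mulVec, hs, Matrix.mulVec_zero, add_zero, hx0])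
  have hs0 : 0 < rdot (toComplex G⁻¹ *ᵥ x) (toComplex G⁻¹ *ᵥ x) := by
    refine rdot_self_pos fun h0 => hx ?_
    rw [← hs, h0, Matrix.mulVec_zero]
  rw [rdot_zero (0 : ν → ℂ)] at hle
  have h1 := mul_nonneg (inv_nonneg.2 hγ.le) (rdot_self_nonneg
    (toComplex (C * G + D * Z) *ᵥ toComplex G⁻¹ *ᵥ x + toComplex Dw *ᵥ 0))
  have h2 := mul_pos hε hs0
  by_contra! hn
  have h3 : 0 ≤ (‖z‖ ^ 2 - 1) * a := mul_nonneg (by nlinarith) ha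
  linarith

/-- The extended bounded real lemma: the norm bound. -/
theorem hinfNorm_lt_of_negDef_Theta {A B : Matrix σ σ ℝ} {Bv : Matrix σ ν ℝ} {C D : Matrix o σ ℝ}
    {Dw : Matrix o ν ℝ} {γ : ℝ} {G Q Z K : Matrix σ σ ℝ} (hγ : 0 < γ) (hQ : Q.PosDef)
    (h : NegDef (Theta A B Bv C D Dw γ G Q Z)) (hG : IsUnit G) (hK : K * G = Z) :
    hinfNorm (fun z => toComplex (C + D * K) * (z • 1 - toComplex (A + B * K))⁻¹ * toComplex Bv
      + toComplex Dw) < ENNReal.ofReal γ := by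
  have hSchur := isSchur_of_negDef_Theta hγ hQ h hG hK
  obtain ⟨ε, hε, hd⟩ := exists_dissipation hγ hQ h
  have hGc : toComplex G * toComplex G⁻¹ = 1 := by
    rw [← toComplex_mul, Matrix.mul_nonsing_inv _ ((Matrix.isUnit_iff_isUnit_det _).1 hG),
      toComplex_one]
  have hAG : A * G + B * Z = (A + B * K) * G := by
    rw [← hK, Matrix.add_mul, Matrix.mul_assoc]
  have hCG : C * G + D * Z = (C + D * K) * G := by
    rw [← hK, Matrix.add_mul, Matrix.mul_assoc]
  -- Truncating ε at γ keeps γ(γ - δ) nonnegative under the square root. The margin δ does not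
  -- depend on z, so the supremum stays strictly below γ.
  set δ := min ε γ with hδ
  have hδ0 : 0 < δ := lt_min hε hγ
  have hδγ : δ ≤ γ := min_le_right _ _
  have hb : √(γ * (γ - δ)) < γ := by
    rw [Real.sqrt_lt' hγ]
    nlinarith
  refine lt_of_le_of_lt (iSup_le fun z => ?_) ((ENNReal.ofReal_lt_ofReal_iff hγ).2 hb)
  obtain ⟨z, hz⟩ := z
  open scoped Matrix.Norms.L2Operator in
  rw [← ofReal_norm]
  refine ENNReal.ofReal_le_ofReal (l2_opNorm_le_of_rdot _ (Real.sqrt_nonneg _) fun w => ?_)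
  rw [Real.sq_sqrt (mul_nonneg hγ.le (sub_nonneg.2 hδγ))]
  have hu : IsUnit (z • 1 - toComplex (A + B * K)) := by
    by_contra hu
    refine (hSchur z ?_).ne hz
    rwa [spectrum.mem_iff, Algebra.algebraMap_eq_smul_one]
  set W := z • 1 - toComplex (A + B * K) with hW
  set x := W⁻¹ *ᵥ toComplex Bv *ᵥ w with hx
  have hWx : W *ᵥ x = toComplex Bv *ᵥ w := by
    rw [hx, Matrix.mulVec_mulVec, Matrix.mul_nonsing_inv _ ((Matrix.isUnit_iff_isUnit_det _).1 hu),
      Matrix.one_mulVec]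
  have hs : toComplex G *ᵥ (toComplex G⁻¹ *ᵥ x) = x := by
    rw [Matrix.mulVec_mulVec, hGc, Matrix.one_mulVec]
  -- Here x is the state response to w at frequency z; since |z| = 1, the storage term a drops out.
  obtain ⟨a, ha, hle⟩ := hd z (toComplex G⁻¹ *ᵥ x) w (by
    rw [hs, hAG, toComplex_mul, ← Matrix.mulVec_mulVec, hs, ← hWx, hW, Matrix.sub_mulVec,
      Matrix.smul_mulVec, Matrix.one_mulVec, add_sub_cancel])
  rw [hCG, toComplex_mul, ← Matrix.mulVec_mulVec, hs, hz] at hle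
  rw [Matrix.add_mulVec, ← Matrix.mulVec_mulVec, ← Matrix.mulVec_mulVec, ← hx]
  have h1 := mul_nonneg hε.le (rdot_self_nonneg (toComplex G⁻¹ *ᵥ x))
  have h2 := mul_le_mul_of_nonneg_right (min_le_left ε γ) (rdot_self_nonneg w)
  have h3 : γ⁻¹ * rdot (toComplex (C + D * K) *ᵥ x + toComplex Dw *ᵥ w)
      (toComplex (C + D * K) *ᵥ x + toComplex Dw *ᵥ w) ≤ (γ - δ) * rdot w w := by
    rw [sub_mul]
    linarith
  rw [inv_mul_le_iff₀ hγ] at h3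
  linarith

end BoundedReal

/-! ### Block-diagonal matrices -/

section BlockDiagonal

variable {κ : Type*} {m : κ → Type*} [Fintype κ] [DecidableEq κ] [∀ k, Fintype (m k)]

theorem posDef_blockDiagonal' {M : ∀ k, Matrix (m k) (m k) ℝ} (hM : ∀ k, (M k).PosDef) :
    (Matrix.blockDiagonal' M).PosDef := by
  rw [posDef_iff_real]
  refine ⟨?_, fun x hx => ?_⟩
  · rw [Matrix.blockDiagonal'_transpose]
    exact congrArg _ (funext fun k => (posDef_iff_real.1 (hM k)).1)
  · have hsum : x ⬝ᵥ Matrix.blockDiagonal' M *ᵥ x =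
        ∑ k, (fun a => x ⟨k, a⟩) ⬝ᵥ M k *ᵥ fun a => x ⟨k, a⟩ := by
      simp only [dotProduct, Matrix.mulVec, Fintype.sum_sigma]
      refine Finset.sum_congr rfl fun k _ => Finset.sum_congr rfl fun a _ => ?_
      rw [Finset.sum_eq_single k]
      · simp
      · intro k' _ hk'
        refine Finset.sum_eq_zero fun b _ => ?_
        rw [Matrix.blockDiagonal'_apply_ne _ _ _ (Ne.symm hk'), zero_mul]
      · simp
    rw [hsum]
    obtain ⟨⟨k, a⟩, hka⟩ := Function.ne_iff.1 hx
    refine Finset.sum_pos' (fun k _ => ?_) ⟨k, Finset.mem_univ k, ?_⟩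
    · exact (posSemidef_iff_real.1 (hM k).posSemidef).2 _
    · exact (posDef_iff_real.1 (hM k)).2 _ fun h => hka (congrFun h a)

theorem inv_blockDiagonal' [∀ k, DecidableEq (m k)] {M : ∀ k, Matrix (m k) (m k) ℝ}
    (hM : IsUnit (Matrix.blockDiagonal' M)) :
    (Matrix.blockDiagonal' M)⁻¹ = Matrix.blockDiagonal' fun k => (M k)⁻¹ := by
  -- The diagonal blocks of the full inverse are right inverses of the blocks, so each block is
  -- invertible.
  have hk : ∀ k, M k * Matrix.blockDiag' (Matrix.blockDiagonal' M)⁻¹ k = 1 := by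
    intro k
    have h := Matrix.mul_nonsing_inv _ ((Matrix.isUnit_iff_isUnit_det _).1 hM)
    ext a b
    have hab := congrFun (congrFun h ⟨k, a⟩) ⟨k, b⟩
    rw [Matrix.mul_apply, Fintype.sum_sigma, Finset.sum_eq_single k] at hab
    · rw [Matrix.mul_apply]
      simpa [Matrix.one_apply, Matrix.blockDiag'_apply] using hab
    · intro k' _ hk'
      refine Finset.sum_eq_zero fun c _ => ?_
      rw [Matrix.blockDiagonal'_apply_ne _ _ _ (Ne.symm hk'), zero_mul]
    · simp
  refine Matrix.inv_eq_right_inv ?_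
  rw [← Matrix.blockDiagonal'_mul, ← Matrix.blockDiagonal'_one]
  refine congrArg _ (funext fun k => ?_)
  exact Matrix.mul_nonsing_inv _ ((Matrix.isUnit_iff_isUnit_det _).1 (.of_mul_eq_one _ (hk k)))

end BlockDiagonal

/-! ### The matrix E, its pseudoinverse and the clique-wise lifts -/

section Clique

variable {N q : ℕ} (n : Fin N → ℕ) (C : Fin q → Finset (Fin N))

/-- The coordinate of `ℝⁿ` that a coordinate of the dilated space copies. -/
def nodeIdx (r : CliqueIdx n C) : StateIdx n := ⟨r.2.1.1, r.2.2⟩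

/-- The number of cliques that contain node `i`. -/
def multiplicity (i : Fin N) : ℝ := ∑ k, if i ∈ C k then 1 else 0

/-- The number of cliques that contain the nodes `i` and `j`. -/
def pairMultiplicity (i j : Fin N) : ℝ := ∑ k, if i ∈ C k ∧ j ∈ C k then 1 else 0

variable {C} in
theorem multiplicity_pos (hcover : ∀ i, ∃ k, i ∈ C k) (i : Fin N) : 0 < multiplicity C i := by
  obtain ⟨k, hk⟩ := hcover i
  refine Finset.sum_pos' (fun k _ => ?_) ⟨k, Finset.mem_univ k, by simp [hk]⟩
  split_ifs <;> simp

variable {C} in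
theorem pairMultiplicity_ne_zero {i j : Fin N} (h : ∃ k, i ∈ C k ∧ j ∈ C k) :
    pairMultiplicity C i j ≠ 0 := by
  obtain ⟨k, hk⟩ := h
  refine (Finset.sum_pos' (fun k _ => ?_) ⟨k, Finset.mem_univ k, by simp [hk]⟩).ne'
  split_ifs <;> simp

theorem E_apply (r : CliqueIdx n C) (s : StateIdx n) :
    E n C r s = if nodeIdx n C r = s then 1 else 0 := rfl

theorem sum_nodeIdx_eq (f : CliqueIdx n C → ℝ) (i : Fin N) (a : Fin (n i)) :
    ∑ r, (if nodeIdx n C r = ⟨i, a⟩ then f r else 0) =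
      ∑ k, if h : i ∈ C k then f ⟨k, ⟨i, h⟩, a⟩ else 0 := by
  rw [Fintype.sum_sigma]
  refine Finset.sum_congr rfl fun k _ => ?_
  rw [Fintype.sum_sigma]
  split_ifs with h
  · rw [Finset.sum_eq_single ⟨i, h⟩, Finset.sum_eq_single a]
    · simp [nodeIdx]
    · intro b _ hb
      simp [nodeIdx, hb]
    · simp
    · intro j _ hj
      refine Finset.sum_eq_zero fun b _ => if_neg fun hb => hj ?_
      exact Subtype.ext (congrArg Sigma.fst hb)
    · simp
  · refine Finset.sum_eq_zero fun j _ => Finset.sum_eq_zero fun b _ => if_neg fun hb => h ?_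
    have : j.1 = i := congrArg Sigma.fst hb
    exact this ▸ j.2

theorem transpose_E_mul_apply {β : Type*} (X : Matrix (CliqueIdx n C) β ℝ) (i : Fin N)
    (a : Fin (n i)) (c : β) :
    ((E n C)ᵀ * X) ⟨i, a⟩ c = ∑ k, if h : i ∈ C k then X ⟨k, ⟨i, h⟩, a⟩ c else 0 := by
  rw [← sum_nodeIdx_eq n C (fun r => X r c), Matrix.mul_apply]
  simp [E_apply]

theorem mul_E_apply {β : Type*} (X : Matrix β (CliqueIdx n C) ℝ) (c : β) (j : Fin N)
    (b : Fin (n j)) :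
    (X * E n C) c ⟨j, b⟩ = ∑ k, if h : j ∈ C k then X c ⟨k, ⟨j, h⟩, b⟩ else 0 := by
  rw [← sum_nodeIdx_eq n C (fun r => X c r), Matrix.mul_apply]
  simp [E_apply]

theorem E_mul_apply {β : Type*} (X : Matrix (StateIdx n) β ℝ) (r : CliqueIdx n C) (c : β) :
    (E n C * X) r c = X (nodeIdx n C r) c := by
  simp [Matrix.mul_apply, E_apply]

/-- Each row of E has a single 1, and the column of a coordinate has one 1 for each clique
containing its node. -/
theorem transpose_E_mul_E :
    (E n C)ᵀ * E n C = Matrix.diagonal fun s : StateIdx n => multiplicity C s.1 := by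
  ext ⟨i, a⟩ t
  rw [transpose_E_mul_apply, Matrix.diagonal_apply, multiplicity]
  by_cases h : (⟨i, a⟩ : StateIdx n) = t
  · simp [E_apply, nodeIdx, h]
  · simp [E_apply, nodeIdx, h]

theorem transpose_E_mul_blockDiagonal'_mul_E
    (W : (k : Fin q) → Matrix (BlockIdx n (C k)) (BlockIdx n (C k)) ℝ) (i j : Fin N)
    (a : Fin (n i)) (b : Fin (n j)) :
    ((E n C)ᵀ * Matrix.blockDiagonal' W * E n C) ⟨i, a⟩ ⟨j, b⟩ =
      ∑ k, if h : i ∈ C k ∧ j ∈ C k then W k ⟨⟨i, h.1⟩, a⟩ ⟨⟨j, h.2⟩, b⟩ else 0 := by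
  rw [mul_E_apply]
  refine Finset.sum_congr rfl fun k _ => ?_
  by_cases hj : j ∈ C k
  · rw [dif_pos hj, transpose_E_mul_apply, Finset.sum_eq_single k]
    · by_cases hi : i ∈ C k
      · simp [hi, hj]
      · simp [hi]
    · intro k' _ hk'
      split_ifs
      · exact Matrix.blockDiagonal'_apply_ne _ _ _ hk'
      · rfl
    · simp
  · simp [hj]

/-- The multiplicities of the coordinates, as a diagonal matrix. -/
def multMatrix : Matrix (StateIdx n) (StateIdx n) ℝ :=
  Matrix.diagonal fun s => multiplicity C s.1

theorem multMatrix_transpose : (multMatrix n C)ᵀ = multMatrix n C :=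
  Matrix.diagonal_transpose _

theorem Epinv_eq : Epinv n C = (multMatrix n C)⁻¹ * (E n C)ᵀ := by
  rw [Epinv, transpose_E_mul_E, multMatrix]

theorem Epinv_transpose : (Epinv n C)ᵀ = E n C * (multMatrix n C)⁻¹ := by
  rw [Epinv_eq, Matrix.transpose_mul, Matrix.transpose_transpose, Matrix.transpose_nonsing_inv,
    multMatrix_transpose]

theorem E_mul_Epinv_transpose : (E n C * Epinv n C)ᵀ = E n C * Epinv n C := by
  rw [Matrix.transpose_mul, Epinv_transpose, Epinv_eq, Matrix.mul_assoc]

theorem projN_transpose : (projN n C)ᵀ = projN n C := by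
  rw [projN, Matrix.transpose_sub, E_mul_Epinv_transpose, Matrix.transpose_one]

section Cover

variable {C} (hcover : ∀ i, ∃ k, i ∈ C k)
include hcover

theorem multMatrix_det : IsUnit (multMatrix n C).det := by
  rw [multMatrix, Matrix.det_diagonal, isUnit_iff_ne_zero, Finset.prod_ne_zero_iff]
  exact fun s _ => (multiplicity_pos hcover s.1).ne'

theorem Epinv_mul_E : Epinv n C * E n C = 1 := by
  rw [Epinv_eq, Matrix.mul_assoc, transpose_E_mul_E, ← multMatrix,
    Matrix.nonsing_inv_mul _ (multMatrix_det n hcover)]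

theorem transpose_E_mul_transpose_Epinv : (E n C)ᵀ * (Epinv n C)ᵀ = 1 := by
  rw [← Matrix.transpose_mul, Epinv_mul_E n hcover, Matrix.transpose_one]

theorem projN_mul_E : projN n C * E n C = 0 := by
  rw [projN, Matrix.sub_mul, Matrix.mul_assoc, Epinv_mul_E n hcover, Matrix.mul_one,
    Matrix.one_mul, sub_self]

theorem projN_mul_projN : projN n C * projN n C = projN n C := by
  nth_rw 2 [projN]
  rw [Matrix.mul_sub, ← Matrix.mul_assoc, projN_mul_E n hcover, Matrix.zero_mul, Matrix.mul_one,
    sub_zero]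

theorem projN_mul_transpose_Epinv : projN n C * (Epinv n C)ᵀ = 0 := by
  rw [Epinv_transpose, ← Matrix.mul_assoc, projN_mul_E n hcover, Matrix.zero_mul]

theorem projN_posSemidef : (projN n C).PosSemidef := by
  have := Matrix.posSemidef_conjTranspose_mul_self (projN n C)
  rwa [Matrix.conjTranspose_eq_transpose_of_trivial, projN_transpose,
    projN_mul_projN n hcover] at this

theorem inv_multMatrix_mul_mem_sparse {𝒢 : SimpleGraph (Fin N)}
    {X : Matrix (StateIdx n) (StateIdx n) ℝ} (hX : X ∈ sparse 𝒢 n) :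
    (multMatrix n C)⁻¹ * X ∈ sparse 𝒢 n := by
  intro i j hij hadj a b
  have hinv : (multMatrix n C)⁻¹ = Matrix.diagonal fun s => (multiplicity C s.1)⁻¹ := by
    refine Matrix.inv_eq_right_inv ?_
    rw [multMatrix, Matrix.diagonal_mul_diagonal, ← Matrix.diagonal_one]
    exact congrArg _ (funext fun s => mul_inv_cancel₀ (multiplicity_pos hcover s.1).ne')
  rw [hinv, Matrix.diagonal_mul, hX i j hij hadj, mul_zero]

end Cover

variable {n}

/-- Every matrix with the sparsity pattern of the cliques is a sum of matrices supported on the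
cliques. -/
theorem exists_transpose_E_mul_blockDiagonal'_mul_E
    (X : Matrix (StateIdx n) (StateIdx n) ℝ)
    (hX : ∀ i j : Fin N, (¬ ∃ k, i ∈ C k ∧ j ∈ C k) → ∀ (a : Fin (n i)) (b : Fin (n j)),
      X ⟨i, a⟩ ⟨j, b⟩ = 0) :
    ∃ W : (k : Fin q) → Matrix (BlockIdx n (C k)) (BlockIdx n (C k)) ℝ,
      (E n C)ᵀ * Matrix.blockDiagonal' W * E n C = X := by
  -- An entry (i, j) is counted once for every clique containing both nodes, so it is shared equally
  -- among them. For nodes with no common clique both sides vanish.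
  refine ⟨fun k => Matrix.of fun r s =>
    X ⟨r.1.1, r.2⟩ ⟨s.1.1, s.2⟩ / pairMultiplicity C r.1.1 s.1.1, ?_⟩
  ext ⟨i, a⟩ ⟨j, b⟩
  rw [transpose_E_mul_blockDiagonal'_mul_E]
  have hsum : (∑ k, if h : i ∈ C k ∧ j ∈ C k then
      X ⟨i, a⟩ ⟨j, b⟩ / pairMultiplicity C i j else 0) =
      pairMultiplicity C i j * (X ⟨i, a⟩ ⟨j, b⟩ / pairMultiplicity C i j) := by
    rw [pairMultiplicity, Finset.sum_mul]
    refine Finset.sum_congr rfl fun k _ => ?_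
    split_ifs <;> simp
  refine hsum.trans ?_
  by_cases h : ∃ k, i ∈ C k ∧ j ∈ C k
  · exact mul_div_cancel₀ _ (pairMultiplicity_ne_zero h)
  · rw [hX i j h, zero_div, mul_zero]

/-- The clique-wise copy of a node-wise block-diagonal matrix, each block scaled by the
multiplicity of its node. -/
def liftBlocks (G : (i : Fin N) → Matrix (Fin (n i)) (Fin (n i)) ℝ) (k : Fin q) :
    Matrix (BlockIdx n (C k)) (BlockIdx n (C k)) ℝ :=
  Matrix.blockDiagonal' fun j : {j // j ∈ C k} => multiplicity C j.1 • G j.1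

/-- All copies of a node carry the same block, so the lift preserves range E. The multiplicity
cancels the H⁻¹ in Pᵀ = EH⁻¹, so compressing the lift by P gives back G. -/
theorem liftBlocks_mul_E (G : (i : Fin N) → Matrix (Fin (n i)) (Fin (n i)) ℝ) :
    Matrix.blockDiagonal' (liftBlocks C G) * E n C =
      E n C * (Matrix.blockDiagonal' G * multMatrix n C) := by
  ext ⟨k, ⟨i, hi⟩, a⟩ ⟨j, b⟩
  rw [mul_E_apply, E_mul_apply, multMatrix, Matrix.mul_diagonal, Finset.sum_eq_single k]
  · rw [nodeIdx]
    rcases eq_or_ne i j with rfl | hij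
    · simp [hi, liftBlocks, mul_comm]
    · rw [Matrix.blockDiagonal'_apply_ne _ _ _ hij, zero_mul]
      split_ifs with hj
      · rw [Matrix.blockDiagonal'_apply_eq]
        exact Matrix.blockDiagonal'_apply_ne _ _ _ fun h => hij (congrArg Subtype.val h)
      · rfl
  · intro k' _ hk'
    split_ifs
    · exact Matrix.blockDiagonal'_apply_ne _ _ _ (Ne.symm hk')
    · rfl
  · simp

theorem liftBlocks_transpose (G : (i : Fin N) → Matrix (Fin (n i)) (Fin (n i)) ℝ) :
    (Matrix.blockDiagonal' (liftBlocks C G))ᵀ =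
      Matrix.blockDiagonal' (liftBlocks C fun i => (G i)ᵀ) := by
  rw [Matrix.blockDiagonal'_transpose]
  refine congrArg _ (funext fun k => ?_)
  rw [liftBlocks, Matrix.blockDiagonal'_transpose]
  rfl

theorem transpose_E_mul_liftBlocks (G : (i : Fin N) → Matrix (Fin (n i)) (Fin (n i)) ℝ) :
    (E n C)ᵀ * Matrix.blockDiagonal' (liftBlocks C G) =
      multMatrix n C * Matrix.blockDiagonal' G * (E n C)ᵀ := by
  have h := congrArg Matrix.transpose (liftBlocks_mul_E C fun i => (G i)ᵀ)
  rwa [Matrix.transpose_mul, Matrix.transpose_mul, Matrix.transpose_mul, multMatrix_transpose,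
    liftBlocks_transpose, Matrix.blockDiagonal'_transpose] at h

theorem liftBlocks_add_transpose_posDef {C : Fin q → Finset (Fin N)}
    (hcover : ∀ i, ∃ k, i ∈ C k)
    {G : (i : Fin N) → Matrix (Fin (n i)) (Fin (n i)) ℝ} (hG : ∀ i, (G i + (G i)ᵀ).PosDef) :
    (Matrix.blockDiagonal' (liftBlocks C G) +
      (Matrix.blockDiagonal' (liftBlocks C G))ᵀ).PosDef := by
  rw [liftBlocks_transpose, ← Matrix.blockDiagonal'_add]
  refine posDef_blockDiagonal' fun k => ?_
  rw [Pi.add_apply, liftBlocks, liftBlocks, ← Matrix.blockDiagonal'_add]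
  refine posDef_blockDiagonal' fun j => ?_
  rw [Pi.add_apply, ← smul_add]
  exact (hG j).smul (multiplicity_pos hcover j)

end Clique

/-! ### Symmetry and diagonal blocks of `Theta` -/

section ThetaBlocks

variable {σ ν o : Type*} [Fintype σ] [DecidableEq ν] [DecidableEq o]

theorem Theta_transpose (A B : Matrix σ σ ℝ) (Bv : Matrix σ ν ℝ) (C D : Matrix o σ ℝ)
    (Dw : Matrix o ν ℝ) (γ : ℝ) (G Z : Matrix σ σ ℝ) {Q : Matrix σ σ ℝ} (hQ : Qᵀ = Q) :
    (Theta A B Bv C D Dw γ G Q Z)ᵀ = Theta A B Bv C D Dw γ G Q Z := by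
  simp only [Theta, Matrix.fromBlocks_transpose, Matrix.transpose_transpose, Matrix.transpose_neg,
    Matrix.transpose_sub, Matrix.transpose_smul, Matrix.transpose_one, Matrix.transpose_zero, hQ]
  rw [sub_right_comm]

theorem Theta_self_eq_Gamma (A B : Matrix σ σ ℝ) (Bv : Matrix σ ν ℝ) (C D : Matrix o σ ℝ)
    (Dw : Matrix o ν ℝ) (γ : ℝ) (Z : Matrix σ σ ℝ) {Q : Matrix σ σ ℝ} (hQ : Qᵀ = Q) :
    Theta A B Bv C D Dw γ Q Q Z = Gamma A B Bv C D Dw γ Q Z := by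
  rw [Theta, Gamma, hQ, sub_self, zero_sub]

variable [Fintype ν] [Fintype o]

theorem add_transpose_sub_posDef_of_negDef_Theta {A B : Matrix σ σ ℝ} {Bv : Matrix σ ν ℝ}
    {C D : Matrix o σ ℝ} {Dw : Matrix o ν ℝ} {γ : ℝ} {G Q Z : Matrix σ σ ℝ}
    (h : NegDef (Theta A B Bv C D Dw γ G Q Z)) : (G + Gᵀ - Q).PosDef := by
  have h' := Matrix.PosDef.submatrix (e := fun s : σ => (Sum.inl (Sum.inr s) : (σ ⊕ σ) ⊕ (ν ⊕ o)))
    h (fun s t hst => by simpa using hst)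
  convert h' using 1
  ext i j
  simp [Theta]
  ring

/-- The second diagonal block forces G + Gᵀ ≻ Q ≻ 0, which excludes a kernel vector of G. -/
theorem isUnit_of_negDef_Theta [DecidableEq σ] {A B : Matrix σ σ ℝ} {Bv : Matrix σ ν ℝ}
    {C D : Matrix o σ ℝ} {Dw : Matrix o ν ℝ} {γ : ℝ} {G Q Z : Matrix σ σ ℝ} (hQ : Q.PosDef)
    (h : NegDef (Theta A B Bv C D Dw γ G Q Z)) : IsUnit G := by
  refine isUnit_of_forall_mulVec fun x hx => ?_
  by_contra hx0
  have h1 := (posDef_iff_real.1 (add_transpose_sub_posDef_of_negDef_Theta h)).2 x hx0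
  have h2 := (posDef_iff_real.1 hQ).2 x hx0
  have h3 : x ⬝ᵥ Gᵀ *ᵥ x = 0 := by
    rw [Matrix.dotProduct_mulVec, Matrix.vecMul_transpose, hx, zero_dotProduct]
  rw [Matrix.sub_mulVec, Matrix.add_mulVec, hx, dotProduct_sub, dotProduct_add, h3,
    dotProduct_zero] at h1
  linarith

end ThetaBlocks

/-! ### Passing between the original and the dilated inequality -/

section Dilation

variable {N q : ℕ} (n : Fin N → ℕ) (C : Fin q → Finset (Fin N)) (mv l : ℕ)

/-- The embedding `blkdiag(Pᵀ, Pᵀ, I, I)`, with `P = (EᵀE)⁻¹ Eᵀ`, of the coordinates of the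
inequality for the plant into those of the dilated inequality. -/
noncomputable def dilation : Matrix ((CliqueIdx n C ⊕ CliqueIdx n C) ⊕ (Fin mv ⊕ Fin l))
    ((StateIdx n ⊕ StateIdx n) ⊕ (Fin mv ⊕ Fin l)) ℝ :=
  Matrix.fromBlocks (Matrix.fromBlocks (Epinv n C)ᵀ 0 0 (Epinv n C)ᵀ) 0 0 1

/-- The left inverse `blkdiag(Eᵀ, Eᵀ, I, I)` of `dilation`. -/
noncomputable def contraction : Matrix ((StateIdx n ⊕ StateIdx n) ⊕ (Fin mv ⊕ Fin l))
    ((CliqueIdx n C ⊕ CliqueIdx n C) ⊕ (Fin mv ⊕ Fin l)) ℝ :=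
  Matrix.fromBlocks (Matrix.fromBlocks (E n C)ᵀ 0 0 (E n C)ᵀ) 0 0 1

/-- Together with `bigM_mul_dilation`, this identifies the range of `dilation` with the kernel of
`bigM`. -/
theorem dilation_mul_contraction :
    dilation n C mv l * contraction n C mv l = 1 - bigM n C mv l := by
  have h : (Epinv n C)ᵀ * (E n C)ᵀ = 1 - projN n C := by
    rw [projN, sub_sub_cancel, ← Matrix.transpose_mul, E_mul_Epinv_transpose]
  rw [eq_sub_iff_add_eq]
  simp [dilation, contraction, bigM, Matrix.fromBlocks_multiply, h, Matrix.fromBlocks_add]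

theorem bigM_transpose : (bigM n C mv l)ᵀ = bigM n C mv l := by
  simp [bigM, Matrix.fromBlocks_transpose, projN_transpose]

section Cover

variable {C} (hcover : ∀ i, ∃ k, i ∈ C k)
include hcover

theorem contraction_mul_dilation : contraction n C mv l * dilation n C mv l = 1 := by
  simp [dilation, contraction, Matrix.fromBlocks_multiply,
    transpose_E_mul_transpose_Epinv n hcover]

theorem bigM_mul_dilation : bigM n C mv l * dilation n C mv l = 0 := by
  simp [dilation, bigM, Matrix.fromBlocks_multiply, projN_mul_transpose_Epinv n hcover]

theorem bigM_posSemidef : (bigM n C mv l).PosSemidef := by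
  have h := Matrix.posSemidef_conjTranspose_mul_self (bigM n C mv l)
  rw [Matrix.conjTranspose_eq_transpose_of_trivial, bigM_transpose] at h
  convert h using 1
  simp [bigM, Matrix.fromBlocks_multiply, projN_mul_projN n hcover]

variable {n mv l}

/-- The dilated data already end in P and begin with E where needed, so PE = I collapses, for
example, PÃG̃Pᵀ to A(PG̃Pᵀ). -/
theorem dilation_congruence (S : Plant n mv l) (γ : ℝ)
    (G Q Z : Matrix (CliqueIdx n C) (CliqueIdx n C) ℝ) :
    (dilation n C mv l)ᵀ * ThetaDilated S C γ G Q Z * dilation n C mv l =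
      Theta S.A S.B S.Bv S.C S.D S.Dw γ (Epinv n C * G * (Epinv n C)ᵀ)
        (Epinv n C * Q * (Epinv n C)ᵀ) (Epinv n C * Z * (Epinv n C)ᵀ) := by
  have hPE : ∀ {β : Type} (X : Matrix (StateIdx n) β ℝ), Epinv n C * (E n C * X) = X := by
    intro β X
    rw [← Matrix.mul_assoc, Epinv_mul_E n hcover, Matrix.one_mul]
  simp only [dilation, ThetaDilated, Theta, Matrix.fromBlocks_transpose, Matrix.fromBlocks_multiply,
    Matrix.transpose_transpose, Matrix.transpose_zero, Matrix.transpose_one, Matrix.mul_zero,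
    Matrix.zero_mul, Matrix.mul_one, Matrix.one_mul, add_zero, zero_add, Matrix.transpose_add,
    Matrix.transpose_mul, Matrix.add_mul, Matrix.mul_add, Matrix.sub_mul, Matrix.mul_sub,
    Matrix.neg_mul, Matrix.mul_neg, Matrix.mul_assoc, hPE,
    transpose_E_mul_transpose_Epinv n hcover, sub_zero, neg_zero]

theorem negDef_Theta_of_dilated {S : Plant n mv l} {γ ρ : ℝ}
    {G Q Z : Matrix (CliqueIdx n C) (CliqueIdx n C) ℝ}
    (h : NegDef (ThetaDilated S C γ G Q Z + ρ • bigM n C mv l)) :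
    NegDef (Theta S.A S.B S.Bv S.C S.D S.Dw γ (Epinv n C * G * (Epinv n C)ᵀ)
      (Epinv n C * Q * (Epinv n C)ᵀ) (Epinv n C * Z * (Epinv n C)ᵀ)) := by
  have hinj : Function.Injective (dilation n C mv l).mulVec := by
    refine Function.LeftInverse.injective (g := (contraction n C mv l).mulVec) fun x => ?_
    rw [Matrix.mulVec_mulVec, contraction_mul_dilation n mv l hcover, Matrix.one_mulVec]
  have := Matrix.PosDef.conjTranspose_mul_mul_same h hinj
  rw [Matrix.conjTranspose_eq_transpose_of_trivial, Matrix.mul_neg, Matrix.neg_mul,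
    Matrix.mul_add, Matrix.add_mul, dilation_congruence hcover, Matrix.mul_smul, Matrix.smul_mul,
    Matrix.mul_assoc _ (bigM n C mv l), bigM_mul_dilation n mv l hcover, Matrix.mul_zero,
    smul_zero, add_zero] at this
  exact this

/-- By the congruence, the dilated form is negative on the kernel of `bigM`; Finsler's lemma extends
this to all vectors with ρ = -c. -/
theorem exists_negDef_dilated {S : Plant n mv l} {γ : ℝ}
    {G Q Z : Matrix (CliqueIdx n C) (CliqueIdx n C) ℝ} (hQ : Qᵀ = Q)
    (h : NegDef (Theta S.A S.B S.Bv S.C S.D S.Dw γ (Epinv n C * G * (Epinv n C)ᵀ)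
      (Epinv n C * Q * (Epinv n C)ᵀ) (Epinv n C * Z * (Epinv n C)ᵀ))) :
    ∃ ρ : ℝ, NegDef (ThetaDilated S C γ G Q Z + ρ • bigM n C mv l) := by
  obtain ⟨c, -, hc⟩ := exists_smul_sub_posDef (X := ThetaDilated S C γ G Q Z)
    (Theta_transpose _ _ _ _ _ _ _ _ _ hQ) (bigM_posSemidef n mv l hcover) fun x hx hMx => by
      set y := contraction n C mv l *ᵥ x with hy
      have hxy : dilation n C mv l *ᵥ y = x := by
        rw [hy, Matrix.mulVec_mulVec, dilation_mul_contraction, Matrix.sub_mulVec, hMx,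
          Matrix.one_mulVec, sub_zero]
      have hy0 : y ≠ 0 := by
        rintro h0
        rw [h0, Matrix.mulVec_zero] at hxy
        exact hx hxy.symm
      have := (posDef_iff_real.1 h).2 y hy0
      rw [← dilation_congruence hcover, Matrix.neg_mulVec, dotProduct_neg, ← Matrix.mulVec_mulVec,
        hxy, ← Matrix.mulVec_mulVec, Matrix.dotProduct_mulVec, Matrix.vecMul_transpose, hxy] at this
      linarith
  refine ⟨-c, ?_⟩
  rw [NegDef, neg_smul, neg_add, neg_neg, add_comm, ← sub_eq_add_neg]
  exact hc

end Cover

end Dilation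

/-! ### The inclusions between the solution sets -/

section Inclusions

variable {N q mv l : ℕ} {n : Fin N → ℕ} {C : Fin q → Finset (Fin N)} {S : Plant n mv l} {γ : ℝ}

/-- With G̃ = Q̃ symmetric, the block Q̃ - G̃ - G̃ᵀ is -Q̃. -/
theorem KS_subset_KSext : KS S C γ ⊆ KSext S C γ := by
  rintro K ⟨Zb, Qb, ρ, η, hQ, hη, hΓ, hN, rfl⟩
  have hQt := (posDef_iff_real.1 hQ).1
  refine ⟨Matrix.blockDiagonal' Qb, Zb, Qb, ρ, η, hQ, hη, ?_, ?_, rfl⟩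
  · rwa [ThetaDilated, Theta_self_eq_Gamma _ _ _ _ _ _ _ _ hQt]
  · rwa [hQt, add_comm]

variable (hcover : ∀ i, ∃ k, i ∈ C k)
include hcover

/-- EᵀWE couples only nodes sharing a clique, and the diagonal factor H⁻¹ merely scales rows. -/
theorem Epinv_mul_blockDiagonal'_mul_E_mem_sparse {𝒢 : SimpleGraph (Fin N)}
    (hclique : ∀ k, 𝒢.IsClique (C k : Set (Fin N)))
    (W : (k : Fin q) → Matrix (BlockIdx n (C k)) (BlockIdx n (C k)) ℝ) :
    Epinv n C * Matrix.blockDiagonal' W * E n C ∈ sparse 𝒢 n := by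
  rw [Epinv_eq, Matrix.mul_assoc, Matrix.mul_assoc, ← Matrix.mul_assoc (E n C)ᵀ]
  refine inv_multMatrix_mul_mem_sparse n hcover fun i j hij hadj a b => ?_
  rw [transpose_E_mul_blockDiagonal'_mul_E]
  exact Finset.sum_eq_zero fun k _ => dif_neg fun h => hadj (hclique k h.1 h.2 hij)

omit hcover in
/-- A clique-wise LMI multiplier maps `ker (projN)` into itself. -/
theorem projN_mulVec_eq_zero {G : Matrix (CliqueIdx n C) (CliqueIdx n C) ℝ} {η : ℝ}
    (hN : LoewnerGE (Gᵀ * projN n C + projN n C * G) (η • projN n C))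
    {x : CliqueIdx n C → ℝ} (hx : projN n C *ᵥ x = 0) : projN n C *ᵥ G *ᵥ x = 0 := by
  have hself : ∀ y : CliqueIdx n C → ℝ, x ⬝ᵥ projN n C *ᵥ y = 0 := by
    intro y
    rw [Matrix.dotProduct_mulVec, ← projN_transpose, Matrix.vecMul_transpose, hx, zero_dotProduct]
  have hmul : (Gᵀ * projN n C + projN n C * G - η • projN n C) *ᵥ x = projN n C *ᵥ G *ᵥ x := by
    rw [Matrix.sub_mulVec, Matrix.add_mulVec, Matrix.smul_mulVec, ← Matrix.mulVec_mulVec,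
      ← Matrix.mulVec_mulVec, hx, Matrix.mulVec_zero, smul_zero, zero_add, sub_zero]
  -- The positive semidefinite difference has vanishing quadratic form at x, so it annihilates x; on
  -- x it acts as NG.
  rw [← hmul]
  refine (Matrix.PosSemidef.dotProduct_mulVec_zero_iff hN x).1 ?_
  rw [hmul, star_trivial, hself]

/-- The term in ρ has no known sign, so the second diagonal block alone is not enough. For Gx = 0
the multiplier inequality and η > 0 first give Nx = 0; then the ρ term disappears and the block
yields -xᵀQx > 0. -/
theorem isUnit_of_negDef_dilated {ρ η : ℝ} {G Q Z : Matrix (CliqueIdx n C) (CliqueIdx n C) ℝ}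
    (hQ : Q.PosDef) (hη : 0 < η) (h : NegDef (ThetaDilated S C γ G Q Z + ρ • bigM n C mv l))
    (hN : LoewnerGE (Gᵀ * projN n C + projN n C * G) (η • projN n C)) : IsUnit G := by
  refine isUnit_of_forall_mulVec fun x hx => ?_
  by_contra hx0
  have hGt : ∀ y : CliqueIdx n C → ℝ, x ⬝ᵥ Gᵀ *ᵥ y = 0 := by
    intro y
    rw [Matrix.dotProduct_mulVec, Matrix.vecMul_transpose, hx, zero_dotProduct]
  have hNp := projN_posSemidef n hcover
  have hNx : projN n C *ᵥ x = 0 := by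
    refine (hNp.dotProduct_mulVec_zero_iff x).1 ?_
    have h1 := (posSemidef_iff_real.1 hN).2 x
    have h2 := (posSemidef_iff_real.1 hNp).2 x
    rw [Matrix.sub_mulVec, Matrix.add_mulVec, Matrix.smul_mulVec, ← Matrix.mulVec_mulVec,
      ← Matrix.mulVec_mulVec, hx, Matrix.mulVec_zero, add_zero, dotProduct_sub, hGt,
      dotProduct_smul, smul_eq_mul] at h1
    rw [star_trivial]
    nlinarith
  have h3 := (posDef_iff_real.1 (Matrix.PosDef.submatrix h
    (e := fun s : CliqueIdx n C => Sum.inl (Sum.inr s)) fun s t hst => by simpa using hst)).2 x hx0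
  have e : (-(ThetaDilated S C γ G Q Z + ρ • bigM n C mv l)).submatrix
      (fun s => Sum.inl (Sum.inr s)) (fun s => Sum.inl (Sum.inr s)) =
      G + Gᵀ - Q - ρ • projN n C := by
    ext i j
    simp [ThetaDilated, Theta, bigM]
    ring
  rw [e, Matrix.sub_mulVec, Matrix.sub_mulVec, Matrix.add_mulVec, Matrix.smul_mulVec, hx, hNx,
    smul_zero, sub_zero, zero_add, dotProduct_sub, hGt] at h3
  linarith [(posDef_iff_real.1 hQ).2 x hx0]

theorem KSext_subset_Kall {𝒢 : SimpleGraph (Fin N)}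
    (hclique : ∀ k, 𝒢.IsClique (C k : Set (Fin N))) (hγ : 0 < γ) :
    KSext S C γ ⊆ Kall 𝒢 S γ := by
  rintro K ⟨Q, Zb, Gb, ρ, η, hQ, hη, hΘ, hN, rfl⟩
  have hG := isUnit_of_negDef_dilated hcover hQ hη hΘ hN
  have hΘ' := negDef_Theta_of_dilated hcover hΘ
  have hQ' : (Epinv n C * Q * (Epinv n C)ᵀ).PosDef := by
    have := Matrix.PosDef.conjTranspose_mul_mul_same (B := (Epinv n C)ᵀ) hQ (by
      refine Function.LeftInverse.injective (g := (E n C)ᵀ.mulVec) fun x => ?_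
      rw [Matrix.mulVec_mulVec, transpose_E_mul_transpose_Epinv n hcover, Matrix.one_mulVec])
    rwa [Matrix.conjTranspose_eq_transpose_of_trivial, Matrix.transpose_transpose] at this
  -- The columns of Pᵀ lie in ker N, which G̃ preserves.
  have hNG : projN n C * (Matrix.blockDiagonal' Gb * (Epinv n C)ᵀ) = 0 := by
    refine Matrix.ext_of_mulVec_single fun i => ?_
    rw [← Matrix.mulVec_mulVec, ← Matrix.mulVec_mulVec, Matrix.zero_mulVec]
    refine projN_mulVec_eq_zero hN ?_
    rw [Matrix.mulVec_mulVec, projN_mul_transpose_Epinv n hcover, Matrix.zero_mulVec]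
  have hEP : E n C * Epinv n C = 1 - projN n C := by rw [projN, sub_sub_cancel]
  -- Invariance lets EP act as the identity on G̃Pᵀ, so G̃⁻¹ cancels G̃: the gain is the one
  -- belonging to the compressed variables.
  have hK : Epinv n C * (Matrix.blockDiagonal' Zb * (Matrix.blockDiagonal' Gb)⁻¹) * E n C *
      (Epinv n C * Matrix.blockDiagonal' Gb * (Epinv n C)ᵀ) =
      Epinv n C * Matrix.blockDiagonal' Zb * (Epinv n C)ᵀ := by
    calc _ = Epinv n C * (Matrix.blockDiagonal' Zb * ((Matrix.blockDiagonal' Gb)⁻¹ *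
          ((E n C * Epinv n C) * (Matrix.blockDiagonal' Gb * (Epinv n C)ᵀ)))) := by
          simp only [Matrix.mul_assoc]
      _ = _ := by
          rw [hEP, Matrix.sub_mul, hNG, sub_zero, Matrix.one_mul,
            Matrix.nonsing_inv_mul_cancel_left _ _ ((Matrix.isUnit_iff_isUnit_det _).1 hG),
            Matrix.mul_assoc]
  have hG' := isUnit_of_negDef_Theta hQ' hΘ'
  refine ⟨?_, isSchur_of_negDef_Theta hγ hQ' hΘ' hG' hK,
    hinfNorm_lt_of_negDef_Theta hγ hQ' hΘ' hG' hK⟩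
  rw [inv_blockDiagonal' hG, ← Matrix.blockDiagonal'_mul]
  exact Epinv_mul_blockDiagonal'_mul_E_mem_sparse hcover hclique _

/-- A null vector x of the sum satisfies Nx = 0 and Eᵀx = 0, hence x = EPx = PᵀEᵀx = 0. -/
theorem posDef_E_mul_mul_add_projN {Q : Matrix (StateIdx n) (StateIdx n) ℝ} (hQ : Q.PosDef) :
    (E n C * Q * (E n C)ᵀ + projN n C).PosDef := by
  have hNp := projN_posSemidef n hcover
  have hE : (E n C * Q * (E n C)ᵀ).PosSemidef := by
    have := hQ.posSemidef.mul_mul_conjTranspose_same (E n C)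
    rwa [Matrix.conjTranspose_eq_transpose_of_trivial] at this
  refine posDef_iff_real.2 ⟨(posSemidef_iff_real.1 (hE.add hNp)).1, fun x hx => ?_⟩
  have h1 := (posSemidef_iff_real.1 hE).2 x
  have h2 := (posSemidef_iff_real.1 hNp).2 x
  rw [Matrix.add_mulVec, dotProduct_add]
  by_contra! hle
  have hNx : projN n C *ᵥ x = 0 :=
    (hNp.dotProduct_mulVec_zero_iff x).1 (by rw [star_trivial]; linarith)
  have hEx : (E n C)ᵀ *ᵥ x = 0 := by
    by_contra h0
    have h3 := (posDef_iff_real.1 hQ).2 _ h0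
    rw [Matrix.mulVec_transpose, ← Matrix.dotProduct_mulVec, ← Matrix.mulVec_transpose,
      Matrix.mulVec_mulVec, Matrix.mulVec_mulVec] at h3
    linarith
  rw [projN, ← E_mul_Epinv_transpose, Matrix.transpose_mul, Matrix.sub_mulVec, Matrix.one_mulVec,
    ← Matrix.mulVec_mulVec, hEx, Matrix.mulVec_zero, sub_zero] at hNx
  exact hx hNx

/-- With L the lift, both L(EP) and (EP)L reduce to EGEᵀ. -/
theorem projN_mul_liftBlocks (G : (i : Fin N) → Matrix (Fin (n i)) (Fin (n i)) ℝ) :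
    projN n C * Matrix.blockDiagonal' (liftBlocks C G) =
      Matrix.blockDiagonal' (liftBlocks C G) * projN n C := by
  have hdet := multMatrix_det n hcover
  rw [projN, Matrix.sub_mul, Matrix.mul_sub, Matrix.one_mul, Matrix.mul_one, Epinv_eq,
    ← Matrix.mul_assoc _ (E n C), liftBlocks_mul_E, Matrix.mul_assoc (E n C), Matrix.mul_assoc _ _
    (Matrix.blockDiagonal' (liftBlocks C G)), transpose_E_mul_liftBlocks]
  congr 1
  rw [Matrix.mul_assoc (multMatrix n C), Matrix.nonsing_inv_mul_cancel_left _ _ hdet,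
    Matrix.mul_assoc (E n C), Matrix.mul_assoc _ (multMatrix n C),
    Matrix.mul_nonsing_inv_cancel_left _ _ hdet]

theorem Kext_subset_KSext {𝒢 : SimpleGraph (Fin N)}
    (hedge : ∀ i j, i ≠ j → 𝒢.Adj i j → ∃ k, i ∈ C k ∧ j ∈ C k) :
    Kext S 𝒢 γ ⊆ KSext S C γ := by
  rintro K ⟨Z, Q, Gb, hZ, hQ, hΘ, rfl⟩
  have hdet := multMatrix_det n hcover
  set G := Matrix.blockDiagonal' Gb with hGdef
  set H := multMatrix n C with hH
  set L := Matrix.blockDiagonal' (liftBlocks C Gb) with hL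
  have hG : IsUnit G := isUnit_of_negDef_Theta hQ hΘ
  have hGdet := (Matrix.isUnit_iff_isUnit_det _).1 hG
  have hGsum : (G + Gᵀ).PosDef := by
    simpa using (add_transpose_sub_posDef_of_negDef_Theta hΘ).add hQ
  have hblock : ∀ i, (Gb i + (Gb i)ᵀ).PosDef := by
    intro i
    convert hGsum.submatrix (e := Sigma.mk i) sigma_mk_injective using 1
    ext a b
    simp [hGdef]
  have hLsum : (L + Lᵀ).PosDef := liftBlocks_add_transpose_posDef hcover hblock
  obtain ⟨η, hη, hLη⟩ := exists_sub_smul_one_posDef hLsum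
  have hLu : IsUnit L := by
    refine isUnit_of_forall_mulVec fun x hx => ?_
    by_contra hx0
    have := (posDef_iff_real.1 hLsum).2 x hx0
    rw [Matrix.add_mulVec, dotProduct_add, Matrix.dotProduct_mulVec x Lᵀ, Matrix.vecMul_transpose,
      hx, dotProduct_zero, zero_dotProduct, add_zero] at this
    exact lt_irrefl _ this
  have hLdet := (Matrix.isUnit_iff_isUnit_det _).1 hLu
  -- The factors H are there to cancel the two H⁻¹ in PZ̃Pᵀ = H⁻¹EᵀZ̃EH⁻¹. They are diagonal, so the
  -- sparsity pattern of Z is kept.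
  obtain ⟨Zb, hZb⟩ := exists_transpose_E_mul_blockDiagonal'_mul_E C (H * Z * H) (by
    intro i j hij a b
    have hne : i ≠ j := by
      rintro rfl
      obtain ⟨k, hk⟩ := hcover i
      exact hij ⟨k, hk, hk⟩
    rw [hH, multMatrix, Matrix.mul_diagonal, Matrix.diagonal_mul,
      hZ i j hne (fun h => hij (hedge i j hne h)), mul_zero, zero_mul])
  have hLE : L * E n C = E n C * (G * H) := liftBlocks_mul_E C Gb
  have hPE := Epinv_mul_E n hcover
  have hPZE : Epinv n C * Matrix.blockDiagonal' Zb * E n C = Z * H := by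
    rw [Epinv_eq, Matrix.mul_assoc, Matrix.mul_assoc, ← Matrix.mul_assoc (E n C)ᵀ, hZb,
      Matrix.mul_assoc, Matrix.nonsing_inv_mul_cancel_left _ _ hdet]
  have hPG : Epinv n C * L * (Epinv n C)ᵀ = G := by
    rw [Epinv_transpose, ← Matrix.mul_assoc, Matrix.mul_assoc (Epinv n C), hLE,
      ← Matrix.mul_assoc (Epinv n C), hPE, Matrix.one_mul,
      Matrix.mul_nonsing_inv_cancel_right _ _ hdet]
  have hPZ : Epinv n C * Matrix.blockDiagonal' Zb * (Epinv n C)ᵀ = Z := by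
    rw [Epinv_transpose, ← Matrix.mul_assoc, hPZE, Matrix.mul_nonsing_inv_cancel_right _ _ hdet]
  have hPQ : Epinv n C * (E n C * Q * (E n C)ᵀ + projN n C) * (Epinv n C)ᵀ = Q := by
    rw [Matrix.mul_assoc, Matrix.add_mul, projN_mul_transpose_Epinv n hcover, add_zero,
      Matrix.mul_assoc, transpose_E_mul_transpose_Epinv n hcover, Matrix.mul_one,
      ← Matrix.mul_assoc, hPE, Matrix.one_mul]
  have hQp := posDef_E_mul_mul_add_projN hcover hQ
  obtain ⟨ρ, hρ⟩ := exists_negDef_dilated hcover (S := S) (γ := γ) (G := L)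
    (Z := Matrix.blockDiagonal' Zb) (posDef_iff_real.1 hQp).1 (by rwa [hPG, hPZ, hPQ])
  refine ⟨_, Zb, liftBlocks C Gb, ρ, η, hQp, hη, hρ, ?_, ?_⟩
  · have hcomm : projN n C * L = L * projN n C := projN_mul_liftBlocks hcover Gb
    have hcomm' : Lᵀ * projN n C = projN n C * Lᵀ := by
      simpa [projN_transpose] using congrArg Matrix.transpose hcomm
    have hNN := projN_mul_projN n hcover
    -- Compressing L + Lᵀ ⪰ ηI by N gives the multiplier inequality, since L and Lᵀ commute with N
    -- and N² = N.
    have := hLη.posSemidef.conjTranspose_mul_mul_same (projN n C)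
    rw [Matrix.conjTranspose_eq_transpose_of_trivial, projN_transpose, Matrix.mul_sub,
      Matrix.mul_add, hcomm, ← hcomm', Matrix.sub_mul, Matrix.add_mul, Matrix.mul_assoc,
      Matrix.mul_assoc, hNN, Matrix.mul_smul, Matrix.mul_one, Matrix.smul_mul, hNN, ← hcomm,
      add_comm] at this
    exact this
  -- The relation LE = EGH, read through L⁻¹, shows that the dilated gain times GH is PZ̃E = ZH;
  -- cancelling H and then G leaves ZG⁻¹.
  · have hLinv : L⁻¹ * E n C * (G * H) = E n C := by
      rw [Matrix.mul_assoc, ← hLE, Matrix.nonsing_inv_mul_cancel_left _ _ hLdet]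
    have h1 : Epinv n C * (Matrix.blockDiagonal' Zb * L⁻¹) * E n C * (G * H) = Z * H := by
      rw [← hPZE]
      simp only [Matrix.mul_assoc] at hLinv ⊢
      rw [hLinv]
    rw [← Matrix.mul_assoc] at h1
    have h2 := congrArg (fun X => X * H⁻¹ * G⁻¹) h1
    simp only [Matrix.mul_nonsing_inv_cancel_right _ _ hdet,
      Matrix.mul_nonsing_inv_cancel_right _ _ hGdet] at h2
    exact h2.symm

end Inclusions

end CliqueHinf

theorem theorem2 {N q mv l : ℕ} (𝒢 : SimpleGraph (Fin N)) (n : Fin N → ℕ)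
    (C : Fin q → Finset (Fin N))
    (hclique : ∀ k, 𝒢.IsClique (C k : Set (Fin N)))
    (hcover : ∀ i, ∃ k, i ∈ C k)
    (hedge : ∀ i j, i ≠ j → ((∃ k, i ∈ C k ∧ j ∈ C k) ↔ 𝒢.Adj i j))
    (S : Plant n mv l) (γ : ℝ) (hγ : 0 < γ) :
    Kext S 𝒢 γ ∪ KS S C γ ⊆ KSext S C γ ∧ KSext S C γ ⊆ Kall 𝒢 S γ :=
  ⟨Set.union_subset (Kext_subset_KSext hcover fun i j hij => (hedge i j hij).2) KS_subset_KSext,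
    KSext_subset_Kall hcover hclique hγ⟩
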